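/- Let $X$ be a compact metric space and let $T\colon X\to X$ be a continuous map. Suppose that $(X,T)$ is uniquely ergodic, that is, there is exactly one Borel probability measure $\mu$ on $X$ that is $T$-invariant, meaning $\mu(T^{-1}A)=\mu(A)$ for every Borel set $A\subset X$. For $n\in\mathbb{N}=\{1,2,3,\ldots\}$ let $\Omega(n)$ denote the number of prime factors of $n$ counted with multiplicity. Then for every $x\in X$ and every continuous function $f\colon X\to\mathbb{C}$, $$\lim_{N\to\infty}\frac1N\sum_{n=1}^N f\big(T^{\Omega(n)}x\big)=\int f\,d\mu .$$ -/

import Mathlib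

open MeasureTheory Filter
open scoped Topology

/-- A Borel probability measure `μ` on `X` is `T`-invariant if `μ (T⁻¹ A) = μ A` for every
Borel set `A`. -/
structure IsInvariantProbability {X : Type*} [MeasurableSpace X] (T : X → X)
    (μ : Measure X) : Prop where
  isProbabilityMeasure : IsProbabilityMeasure μ
  measure_preimage_eq : ∀ A : Set X, MeasurableSet A → μ (T ⁻¹' A) = μ A

/-- The system `(X, T)` is uniquely ergodic if it admits exactly one `T`-invariant Borel
probability measure. -/
def IsUniquelyErgodic {X : Type*} [MeasurableSpace X] (T : X → X) : Prop :=
  ∃! μ : Measure X, IsInvariantProbability T μ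

/-! The heart is that, for bounded `a`, the averages of `a (Ω n)` and `a (Ω n + 1)` over `n ≤ x` are
asymptotically equal. Applied to `a k = f (T^k x)`, this makes every weak limit of the empirical
measures `T`-invariant, hence equal to `μ`; compactness of the space of probability measures gives
convergence.

To compare the averages, Turán–Kubilius shows that the average of `a` up to `x` is close to the
shifted average up to `x / p`, except for primes `p` with bounded reciprocal sum. In ultrafilter
limits `F`, `G`, on a logarithmic scale, this reads `F t ≈ G (t - log p)` (`AlmostShift`). Two good
primes whose logarithms differ by a small `d` give `F (t + d) ≈ F t`. `exists_prime_pair` bounds `d`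
below independently of the exceptional set, so the error can be taken small relative to `d`, and
iteration shows that `F` is constant. The same argument for `G`, paired with the twice-shifted
limit, makes `G` constant, so `F 0 = G 0`. -/

/-! ### Chebyshev-type estimates -/

/-- The primes in `(m, m + h]` all divide `(m + h).choose h`. -/
theorem sum_log_primes_Ioc_le {m h : ℕ} (h1 : 1 ≤ h) (hm : h ≤ m) :
    ∑ p ∈ (Finset.Ioc m (m + h)).filter Nat.Prime, Real.log p ≤
      h * (1 + Real.log ((m + h : ℝ) / h)) := by
  have hdvd : ∏ p ∈ (Finset.Ioc m (m + h)).filter Nat.Prime, p ∣ (m + h).choose h := by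
    refine Finset.prod_primes_dvd _ (fun p hp => ?_) (fun p hp => ?_)
    · exact (Finset.mem_filter.1 hp).2.prime
    · obtain ⟨hp1, hp2⟩ := Finset.mem_filter.1 hp
      rw [Finset.mem_Ioc] at hp1
      exact hp2.dvd_choose (by omega) (by omega) (by omega)
  have hle := Nat.le_of_dvd (Nat.choose_pos (by omega)) hdvd
  have hh : (0 : ℝ) < h := by exact_mod_cast h1
  have hfac : (0 : ℝ) < h.factorial := by exact_mod_cast h.factorial_pos
  have hchoose : ((m + h).choose h : ℝ) ≤ Real.exp h * ((m + h : ℝ) / h) ^ h := by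
    refine (Nat.choose_le_pow_div h (m + h)).trans ?_
    have := Real.pow_div_factorial_le_exp (h : ℝ) hh.le h
    rw [div_le_iff₀ hfac] at this
    rw [div_le_iff₀ hfac, div_pow]
    push_cast
    rw [mul_div_assoc', div_mul_eq_mul_div, le_div_iff₀ (by positivity)]
    nlinarith [pow_nonneg (show (0 : ℝ) ≤ m + h by positivity) h]
  rw [← Real.log_prod]
  · have hpos : (0 : ℝ) < ∏ p ∈ (Finset.Ioc m (m + h)).filter Nat.Prime, (p : ℝ) :=
      Finset.prod_pos fun p hp => by exact_mod_cast (Finset.mem_filter.1 hp).2.pos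
    have hle' : ∏ p ∈ (Finset.Ioc m (m + h)).filter Nat.Prime, (p : ℝ) ≤
        Real.exp h * ((m + h : ℝ) / h) ^ h := by
      refine le_trans ?_ hchoose
      rw [← Nat.cast_prod]
      exact Nat.cast_le.2 hle
    refine (Real.log_le_log hpos hle').trans ?_
    have : (0 : ℝ) < (m + h : ℝ) / h := by positivity
    rw [Real.log_mul (Real.exp_pos _).ne' (by positivity), Real.log_exp, Real.log_pow]
    linarith
  · intro p hp
    exact_mod_cast (Finset.mem_filter.1 hp).2.ne_zero

/-- With `u = 1 / √δ`, use `1 + u ^ 2 ≤ (1 + u) ^ 2` and `log (1 + u) ≤ u`. This turns the loss `δ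
log (1 / δ)` in short intervals into `O(√δ)`. -/
theorem log_one_add_inv_le {δ : ℝ} (h0 : 0 < δ) : Real.log (1 + 1 / δ) ≤ 2 / √δ := by
  have hs : 0 < √δ := Real.sqrt_pos.2 h0
  have h2 : 1 + 1 / δ ≤ (1 + 1 / √δ) ^ 2 := by
    have : (1 / √δ) ^ 2 = 1 / δ := by rw [div_pow, Real.sq_sqrt h0.le, one_pow]
    have h3 : 0 < 1 / √δ := by positivity
    nlinarith
  calc Real.log (1 + 1 / δ) ≤ Real.log ((1 + 1 / √δ) ^ 2) :=
        Real.log_le_log (by positivity) h2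
    _ = 2 * Real.log (1 + 1 / √δ) := by rw [Real.log_pow]; norm_num
    _ ≤ 2 * (1 / √δ) := by
        have := Real.log_le_sub_one_of_pos (show 0 < 1 + 1 / √δ by positivity)
        linarith
    _ = 2 / √δ := by ring

/-- Short multiplicative intervals contain few primes. -/
theorem sum_log_primes_short_le {δ : ℝ} (h0 : 0 < δ) (h1 : δ ≤ 1) {m : ℕ}
    (hlog : Real.log m ≤ √δ * m) (hδm : 1 ≤ δ * m) {S : Finset ℕ}
    (hS : ∀ p ∈ S, p.Prime ∧ m ≤ p ∧ (p : ℝ) ≤ (1 + δ) * m) :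
    ∑ p ∈ S, Real.log p ≤ 7 * √δ * m := by
  set h := ⌈δ * m⌉₊ with hh
  have hs : 0 < √δ := Real.sqrt_pos.2 h0
  have hs1 : √δ ≤ 1 := Real.sqrt_le_one.2 h1
  have hss : √δ * √δ = δ := Real.mul_self_sqrt h0.le
  have hmpos : (0 : ℝ) < m := by
    by_contra hcon
    nlinarith
  have hle : δ * m ≤ h := Nat.le_ceil _
  have hlt : (h : ℝ) < δ * m + 1 := Nat.ceil_lt_add_one (by positivity)
  have hh1 : 1 ≤ h := by
    have : (1 : ℝ) ≤ h := hδm.trans hle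
    exact_mod_cast this
  have hhm : h ≤ m := Nat.ceil_le.2 (by nlinarith)
  -- `Ioc` omits its left endpoint, which `S` may contain.
  have hsub : S ⊆ insert m ((Finset.Ioc m (m + h)).filter Nat.Prime) := by
    intro p hp
    obtain ⟨hp1, hp2, hp3⟩ := hS p hp
    rcases hp2.eq_or_lt with h | h'
    · simp [h]
    · refine Finset.mem_insert_of_mem (Finset.mem_filter.2 ⟨Finset.mem_Ioc.2 ⟨h', ?_⟩, hp1⟩)
      have : (p : ℝ) ≤ m + h := by linarith
      exact_mod_cast this
  have hhpos : (0 : ℝ) < h := by exact_mod_cast hh1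
  have hlog2 : Real.log ((m + h : ℝ) / h) ≤ 2 / √δ := by
    refine (Real.log_le_log (by positivity) ?_).trans (log_one_add_inv_le h0)
    rw [add_div, div_self hhpos.ne', add_comm]
    gcongr 1 + ?_
    rw [div_le_div_iff₀ hhpos h0]
    linarith
  calc ∑ p ∈ S, Real.log p
      ≤ ∑ p ∈ insert m ((Finset.Ioc m (m + h)).filter Nat.Prime), Real.log p :=
        Finset.sum_le_sum_of_subset_of_nonneg hsub fun p _ _ => Real.log_natCast_nonneg p
    _ = Real.log m + ∑ p ∈ (Finset.Ioc m (m + h)).filter Nat.Prime, Real.log p :=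
        Finset.sum_insert (by simp)
    _ ≤ √δ * m + h * (1 + 2 / √δ) := by
        refine add_le_add hlog ((sum_log_primes_Ioc_le hh1 hhm).trans ?_)
        gcongr
    _ ≤ √δ * m + (2 * (δ * m)) * (1 + 2 / √δ) := by
        gcongr
        linarith
    _ = √δ * m + 2 * (√δ * m) * (√δ + 2) := by
        have hd : δ * (2 / √δ) = 2 * √δ := by
          rw [mul_div_assoc', div_eq_iff hs.ne']
          linarith
        linear_combination 2 * (m : ℝ) * hd - 2 * (m : ℝ) * hss
    _ ≤ √δ * m + 2 * (√δ * m) * (1 + 2) := by gcongr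
    _ = 7 * √δ * m := by ring

/-- The crude bounds `θ(4x) ≥ 4x log 2 - o(x)` and `θ(x) ≤ 2x log 2` leave about `2x log 2 > x`.
With ratio 2 instead of 4 the main terms would cancel. -/
theorem eventually_four_pow_le_theta_sub :
    ∀ᶠ n : ℕ in atTop, (4 : ℝ) ^ n ≤
      Chebyshev.theta ((4 ^ (n + 1) : ℕ) : ℝ) - Chebyshev.theta ((4 ^ n : ℕ) : ℝ) := by
  have hlo : ∀ᶠ x : ℝ in atTop, Real.log x ≤ 1 / 100 * x ^ (1 / 2 : ℝ) := by
    have := (isLittleO_log_rpow_atTop (r := 1 / 2) (by norm_num)).bound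
      (show (0 : ℝ) < 1 / 100 by norm_num)
    filter_upwards [this, eventually_ge_atTop 1] with x hx hx1
    rw [Real.norm_of_nonneg (Real.log_nonneg hx1),
      Real.norm_of_nonneg (Real.rpow_nonneg (by linarith) _)] at hx
    exact hx
  have htend : Tendsto (fun n : ℕ => ((4 ^ (n + 1) : ℕ) : ℝ)) atTop atTop := by
    refine tendsto_natCast_atTop_atTop.comp ?_
    exact (tendsto_pow_atTop_atTop_of_one_lt (by norm_num : 1 < 4)).comp (tendsto_add_atTop_nat 1)
  have htend' : Tendsto (fun n : ℕ => ((4 ^ (n + 1) : ℕ) : ℝ) + 1) atTop atTop :=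
    tendsto_atTop_add_const_right _ _ htend
  filter_upwards [htend.eventually hlo, htend'.eventually hlo,
    htend.eventually (eventually_ge_atTop 1)] with n h1 h2 hN1
  have hge := Chebyshev.theta_ge (4 ^ (n + 1))
  have hle := Chebyshev.theta_le_log4_mul_x (x := ((4 ^ n : ℕ) : ℝ)) (by positivity)
  have hlog4 : Real.log 4 = 2 * Real.log 2 := by
    rw [show (4 : ℝ) = 2 ^ 2 by norm_num, Real.log_pow]; norm_num
  have hN : ((4 ^ (n + 1) : ℕ) : ℝ) = 4 * (4 : ℝ) ^ n := by push_cast; ring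
  have hn : ((4 ^ n : ℕ) : ℝ) = (4 : ℝ) ^ n := by push_cast; ring
  rw [hlog4, hn] at hle
  rw [hn]
  set N : ℝ := ((4 ^ (n + 1) : ℕ) : ℝ) with hNdef
  rw [← Real.sqrt_eq_rpow] at h1 h2
  have hNs : √N * √N = N := Real.mul_self_sqrt (by linarith)
  have hs0 : 0 ≤ √N := Real.sqrt_nonneg _
  have hs1 : √(N + 1) ≤ 2 * N := by
    rw [Real.sqrt_le_left (by linarith)]
    nlinarith
  have hl2 := Real.log_two_gt_d9
  have h3 : 2 * √N * Real.log N ≤ 2 / 100 * N := by nlinarith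
  have h4 : Real.log (N + 1) ≤ 2 / 100 * N := by linarith
  nlinarith

/-! ### Close pairs of primes avoiding a sparse set -/

/-- A set of primes whose complement among the primes has a bounded sum of reciprocals contains
pairs of primes whose quotient is close to `1`, but not too close. -/
theorem exists_prime_pair {η : ℝ} (h0 : 0 < η) (h1 : η ≤ 1) :
    ∃ δ : ℝ, 0 < δ ∧ ∀ (E : Set ℕ) (C : ℝ),
      (∀ S : Finset ℕ, (∀ p ∈ S, p.Prime ∧ p ∈ E) → ∑ p ∈ S, (1 / p : ℝ) ≤ C) →
      ∃ p q : ℕ, p.Prime ∧ q.Prime ∧ p ∉ E ∧ q ∉ E ∧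
        (1 + δ) * (p : ℝ) ≤ q ∧ (q : ℝ) ≤ (1 + η) * p := by
  classical
  have hsq : √((η / 300) ^ 2) = η / 300 := Real.sqrt_sq (by positivity)
  refine ⟨(η / 300) ^ 2, by positivity, fun E C hE => ?_⟩
  by_contra hcon
  push Not at hcon
  set δ := (η / 300) ^ 2 with hδ
  have hδ0 : 0 < δ := by positivity
  have hδ1 : δ ≤ 1 := by
    rw [hδ]
    exact pow_le_one₀ (by positivity) (by linarith)
  have hlarge : ∀ᶠ x : ℝ in atTop, Real.log x ≤ √δ * x ∧ 1 ≤ δ * x := by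
    have := Real.isLittleO_log_id_atTop.bound (Real.sqrt_pos.2 hδ0)
    filter_upwards [this, eventually_ge_atTop 1, eventually_ge_atTop (1 / δ)] with x hx hx1 hx2
    rw [Real.norm_of_nonneg (Real.log_nonneg hx1), id, Real.norm_of_nonneg (by linarith)] at hx
    refine ⟨hx, ?_⟩
    rw [div_le_iff₀ hδ0] at hx2
    linarith
  obtain ⟨X, hX⟩ := eventually_atTop.1 hlarge
  have hpowt : Tendsto (fun n : ℕ => (4 : ℝ) ^ n) atTop atTop :=
    tendsto_pow_atTop_atTop_of_one_lt (by norm_num)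
  obtain ⟨n₁, hn₁⟩ := eventually_atTop.1
    ((hpowt.eventually (eventually_ge_atTop X)).and eventually_four_pow_le_theta_sub)
  let I : ℕ → Finset ℕ := fun n => (Finset.Ioc (4 ^ n) (4 ^ (n + 1))).filter Nat.Prime
  have hImem : ∀ n p, p ∈ I n → p.Prime ∧ (4 : ℝ) ^ n < p ∧ (p : ℝ) ≤ 4 * 4 ^ n := by
    intro n p hp
    obtain ⟨hp1, hp2⟩ := Finset.mem_filter.1 hp
    rw [Finset.mem_Ioc] at hp1
    refine ⟨hp2, by exact_mod_cast hp1.1, ?_⟩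
    have : (p : ℝ) ≤ 4 ^ (n + 1) := by exact_mod_cast hp1.2
    rw [pow_succ] at this
    linarith
  have hI : ∀ n, n₁ ≤ n → (4 : ℝ) ^ n ≤ ∑ p ∈ I n, Real.log p := by
    intro n hn
    refine (hn₁ n hn).2.trans (le_of_eq ?_)
    rw [Chebyshev.theta_eq_sum_primesLE_log, Chebyshev.theta_eq_sum_primesLE_log,
      sub_eq_iff_eq_add, ← Finset.sum_union]
    · congr 1
      ext p
      have : 4 ^ n ≤ 4 ^ (n + 1) := Nat.pow_le_pow_right (by norm_num) (by omega)
      simp only [I, Nat.mem_primesLE, Finset.mem_union, Finset.mem_filter, Finset.mem_Ioc]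
      constructor
      · rintro ⟨h, h'⟩
        rcases le_or_gt p (4 ^ n) with hp | hp
        · exact Or.inr ⟨hp, h'⟩
        · exact Or.inl ⟨⟨hp, h⟩, h'⟩
      · rintro (⟨⟨_, h⟩, h'⟩ | ⟨h, h'⟩)
        · exact ⟨h, h'⟩
        · exact ⟨h.trans this, h'⟩
    · rw [Finset.disjoint_left]
      intro p hp hp'
      simp only [I, Nat.mem_primesLE, Finset.mem_filter, Finset.mem_Ioc] at hp hp'
      omega
  -- Cut the range into at most `5 / η` cells of length `η * 4 ^ n`. Without a good pair, the primes
  -- of a cell outside `E` lie within a factor `1 + δ` of the least one, so weigh at most `7 * √δ *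
  -- (4 * 4 ^ n)`; with `√δ = η / 300` the total is `140 / 300 * 4 ^ n`.
  have hgood : ∀ n, n₁ ≤ n → ∑ p ∈ (I n).filter (· ∉ E), Real.log p ≤ 4 ^ n / 2 := by
    intro n hn
    have h4 : (0 : ℝ) < 4 ^ n := by positivity
    have hmaps : ∀ p ∈ (I n).filter (· ∉ E),
        ⌊(p : ℝ) / (η * 4 ^ n)⌋₊ ∈ Finset.range (⌊4 / η⌋₊ + 1) := by
      intro p hp
      rw [Finset.mem_range, Nat.lt_succ_iff]
      refine Nat.floor_le_floor ?_
      rw [div_le_div_iff₀ (by positivity) h0]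
      nlinarith [(hImem n p (Finset.mem_filter.1 hp).1).2.2]
    rw [← Finset.sum_fiberwise_of_maps_to hmaps]
    have hcell : ∀ j ∈ Finset.range (⌊4 / η⌋₊ + 1),
        ∑ p ∈ ((I n).filter (· ∉ E)).filter (fun p : ℕ => ⌊(p : ℝ) / (η * 4 ^ n)⌋₊ = j),
          Real.log p ≤ 7 * (η / 300) * (4 * 4 ^ n) := by
      intro j _
      set S := ((I n).filter (· ∉ E)).filter (fun p : ℕ => ⌊(p : ℝ) / (η * 4 ^ n)⌋₊ = j) with hSdef
      rcases S.eq_empty_or_nonempty with hS | hS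
      · rw [hS, Finset.sum_empty]
        positivity
      have hmem : ∀ p ∈ S, (p.Prime ∧ (4 : ℝ) ^ n < p ∧ (p : ℝ) ≤ 4 * 4 ^ n) ∧ p ∉ E ∧
          (j : ℝ) * (η * 4 ^ n) ≤ p ∧ (p : ℝ) < (j + 1) * (η * 4 ^ n) := by
        intro p hp
        rw [hSdef, Finset.mem_filter, Finset.mem_filter] at hp
        refine ⟨hImem n p hp.1.1, hp.1.2, ?_⟩
        have := (Nat.floor_eq_iff (by positivity)).1 hp.2
        rwa [le_div_iff₀ (by positivity), div_lt_iff₀ (by positivity)] at this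
      set m := S.min' hS with hm
      have hmS : m ∈ S := S.min'_mem hS
      obtain ⟨⟨hm1, hm2, hm3⟩, hm4, hm5, hm6⟩ := hmem m hmS
      have hXm := hX m ((hn₁ n hn).1.trans hm2.le)
      have := sum_log_primes_short_le hδ0 hδ1 (m := m) hXm.1 hXm.2 (S := S) (by
        intro p hp
        obtain ⟨⟨hp1, hp2, hp3⟩, hp4, hp5, hp6⟩ := hmem p hp
        refine ⟨hp1, S.min'_le p hp, ?_⟩
        by_contra hlt
        have := hcon m p hm1 hp1 hm4 hp4 (not_le.1 hlt).le
        nlinarith)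
      rw [hsq] at this
      refine this.trans ?_
      gcongr
    refine (Finset.sum_le_card_nsmul _ _ _ hcell).trans ?_
    rw [Finset.card_range, nsmul_eq_mul]
    have hK : ((⌊4 / η⌋₊ + 1 : ℕ) : ℝ) ≤ 5 / η := by
      push_cast
      have h2 := Nat.floor_le (show 0 ≤ 4 / η by positivity)
      have h3 : 1 ≤ 1 / η := by rw [le_div_iff₀ h0]; linarith
      have h4 : 5 / η = 4 / η + 1 / η := by ring
      linarith
    calc ((⌊4 / η⌋₊ + 1 : ℕ) : ℝ) * (7 * (η / 300) * (4 * 4 ^ n))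
        ≤ 5 / η * (7 * (η / 300) * (4 * 4 ^ n)) := by gcongr
      _ = 140 / 300 * 4 ^ n := by field_simp; ring
      _ ≤ 4 ^ n / 2 := by linarith
  -- So `E` carries at least half of the logarithmic weight of each block; these reciprocal sums
  -- dominate a multiple of the harmonic series.
  have hbad : ∀ n, n₁ ≤ n → (1 / 16 : ℝ) * (1 / (n + 1)) ≤ ∑ p ∈ (I n).filter (· ∈ E), (1 / p : ℝ) := by
    intro n hn
    have h4 : (0 : ℝ) < 4 ^ n := by positivity
    have hsplit := Finset.sum_filter_add_sum_filter_not (I n) (· ∈ E) (fun p : ℕ => Real.log p)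
    have hlow : (4 : ℝ) ^ n / 2 ≤ ∑ p ∈ (I n).filter (· ∈ E), Real.log p := by
      linarith [hI n hn, hgood n hn]
    have hup : ∑ p ∈ (I n).filter (· ∈ E), Real.log p ≤
        ∑ p ∈ (I n).filter (· ∈ E), (8 * 4 ^ n * (n + 1)) * (1 / p : ℝ) := by
      refine Finset.sum_le_sum fun p hp => ?_
      obtain ⟨hp1, hp2, hp3⟩ := hImem n p (Finset.mem_filter.1 hp).1
      have hp0 : (0 : ℝ) < p := h4.trans hp2
      have hlog4 : Real.log 4 ≤ 2 := by
        rw [show (4 : ℝ) = 2 ^ 2 by norm_num, Real.log_pow]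
        have := Real.log_two_lt_d9
        norm_num
        linarith
      have hlogp : Real.log p ≤ 2 * (n + 1) := by
        calc Real.log p ≤ Real.log (4 ^ (n + 1)) :=
              Real.log_le_log hp0 (by rw [pow_succ]; linarith)
          _ = (n + 1) * Real.log 4 := by rw [Real.log_pow]; push_cast; ring
          _ ≤ (n + 1) * 2 := by gcongr
          _ = 2 * (n + 1) := by ring
      rw [mul_one_div, le_div_iff₀ hp0]
      calc Real.log p * p ≤ (2 * (n + 1)) * (4 * 4 ^ n) := by
            gcongr
        _ = 8 * 4 ^ n * (n + 1) := by ring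
    rw [← Finset.mul_sum] at hup
    have h5 : (0 : ℝ) < 8 * 4 ^ n * (n + 1) := by positivity
    have h6 := hlow.trans hup
    rw [mul_comm, ← div_le_iff₀ h5] at h6
    refine le_trans (le_of_eq ?_) h6
    field_simp
    norm_num
  have hdisj : ∀ M : ℕ, ∑ n ∈ Finset.range M, (1 / 16 : ℝ) * (1 / ((n + n₁ : ℕ) + 1)) ≤ C := by
    intro M
    have hd : Set.PairwiseDisjoint (↑(Finset.range M))
        (fun n => (I (n + n₁)).filter (· ∈ E)) := by
      intro i _ j _ hij
      rw [Function.onFun, Finset.disjoint_left]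
      intro p hp hp'
      have h1 := Finset.mem_Ioc.1 (Finset.mem_filter.1 (Finset.mem_filter.1 hp).1).1
      have h2 := Finset.mem_Ioc.1 (Finset.mem_filter.1 (Finset.mem_filter.1 hp').1).1
      have h3 := (Nat.pow_lt_pow_iff_right (by norm_num : 1 < 4)).1 (h1.1.trans_le h2.2)
      have h4 := (Nat.pow_lt_pow_iff_right (by norm_num : 1 < 4)).1 (h2.1.trans_le h1.2)
      omega
    refine (Finset.sum_le_sum fun n _ => hbad (n + n₁) (by omega)).trans ?_
    rw [← Finset.sum_biUnion hd]
    refine hE _ fun p hp => ?_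
    obtain ⟨n, _, hp⟩ := Finset.mem_biUnion.1 hp
    exact ⟨(hImem _ p (Finset.mem_filter.1 hp).1).1, (Finset.mem_filter.1 hp).2⟩
  have hsum := summable_of_sum_range_le (fun n => by positivity) hdisj
  rw [summable_mul_left_iff (by norm_num)] at hsum
  have h2 : Summable (fun n : ℕ => (1 / ((n + (n₁ + 1) : ℕ)) : ℝ)) := by
    refine hsum.congr fun n => ?_
    push_cast
    ring
  exact Real.not_summable_one_div_natCast
    ((summable_nat_add_iff (f := fun n : ℕ => (1 / n : ℝ)) (n₁ + 1)).1 h2)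

/-! ### Averages along `Ω` and the Turán–Kubilius inequality -/

/-- The average of `a (Ω n)` over `1 ≤ n ≤ x`. -/
noncomputable def omegaAverage (a : ℕ → ℝ) (x : ℝ) : ℝ :=
  (1 / x) * ∑ n ∈ Finset.Ioc 0 ⌊x⌋₊, a (ArithmeticFunction.cardFactors n)

theorem abs_sum_le_card {ι : Type*} {s : Finset ι} {b : ι → ℝ} (hb : ∀ i, |b i| ≤ 1) :
    |∑ i ∈ s, b i| ≤ s.card := by
  refine (Finset.abs_sum_le_sum_abs _ _).trans ?_
  refine (Finset.sum_le_card_nsmul _ _ 1 fun i _ => hb i).trans ?_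
  simp

theorem abs_omegaAverage_le {a : ℕ → ℝ} (ha : ∀ k, |a k| ≤ 1) {x : ℝ} (hx : 0 < x) :
    |omegaAverage a x| ≤ 1 := by
  have h := abs_sum_le_card (s := Finset.Ioc 0 ⌊x⌋₊)
    (b := fun n => a (ArithmeticFunction.cardFactors n)) fun n => ha _
  rw [Nat.card_Ioc, Nat.sub_zero] at h
  rw [omegaAverage, abs_mul, abs_of_pos (by positivity : 0 < 1 / x), one_div_mul_eq_div,
    div_le_one hx]
  exact h.trans (Nat.floor_le hx.le)

/-- The new terms and the change of normalisation each cost `1 - x / y`; `1 / y` pays for the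
floors. -/
theorem abs_omegaAverage_sub_le {a : ℕ → ℝ} (ha : ∀ k, |a k| ≤ 1) {x y : ℝ} (hx : 0 < x)
    (hxy : x ≤ y) : |omegaAverage a y - omegaAverage a x| ≤ 2 * (1 - x / y) + 1 / y := by
  have hy : 0 < y := hx.trans_le hxy
  have hfl : ⌊x⌋₊ ≤ ⌊y⌋₊ := Nat.floor_le_floor hxy
  set b : ℕ → ℝ := fun n => a (ArithmeticFunction.cardFactors n) with hb
  have h1 : |∑ n ∈ Finset.Ioc ⌊x⌋₊ ⌊y⌋₊, b n| ≤ y - x + 1 := by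
    refine (abs_sum_le_card fun n => ha _).trans ?_
    rw [Nat.card_Ioc, Nat.cast_sub hfl]
    linarith [Nat.floor_le hy.le, Nat.lt_floor_add_one x]
  have h2 : |∑ n ∈ Finset.Ioc 0 ⌊x⌋₊, b n| ≤ x := by
    refine (abs_sum_le_card fun n => ha _).trans ?_
    rw [Nat.card_Ioc, Nat.sub_zero]
    exact Nat.floor_le hx.le
  have h3 : ∑ n ∈ Finset.Ioc 0 ⌊y⌋₊, b n =
      ∑ n ∈ Finset.Ioc 0 ⌊x⌋₊, b n + ∑ n ∈ Finset.Ioc ⌊x⌋₊ ⌊y⌋₊, b n :=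
    (Finset.sum_Ioc_consecutive b (Nat.zero_le _) hfl).symm
  have h4 : omegaAverage a y - omegaAverage a x =
      (1 / y) * ∑ n ∈ Finset.Ioc ⌊x⌋₊ ⌊y⌋₊, b n -
        ((y - x) / (x * y)) * ∑ n ∈ Finset.Ioc 0 ⌊x⌋₊, b n := by
    rw [omegaAverage, omegaAverage, h3]
    field_simp
    ring
  rw [h4]
  refine (abs_sub _ _).trans ?_
  rw [abs_mul, abs_mul, abs_of_pos (by positivity : 0 < 1 / y),
    abs_of_nonneg (div_nonneg (by linarith) (by positivity) : 0 ≤ (y - x) / (x * y))]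
  calc 1 / y * |∑ n ∈ Finset.Ioc ⌊x⌋₊ ⌊y⌋₊, b n| + (y - x) / (x * y) *
        |∑ n ∈ Finset.Ioc 0 ⌊x⌋₊, b n|
      ≤ 1 / y * (y - x + 1) + (y - x) / (x * y) * x := by
        have : 0 ≤ (y - x) / (x * y) := div_nonneg (by linarith) (by positivity)
        gcongr
    _ = 2 * (1 - x / y) + 1 / y := by field_simp; ring

theorem sum_filter_dvd_Ioc {p : ℕ} (hp : 0 < p) (N : ℕ) (g : ℕ → ℝ) :
    ∑ n ∈ (Finset.Ioc 0 N).filter (p ∣ ·), g n = ∑ m ∈ Finset.Ioc 0 (N / p), g (p * m) := by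
  refine (Finset.sum_bij (fun m _ => p * m) ?_ ?_ ?_ fun _ _ => rfl).symm
  · intro m hm
    rw [Finset.mem_Ioc, Nat.le_div_iff_mul_le hp] at hm
    rw [Finset.mem_filter, Finset.mem_Ioc]
    exact ⟨⟨Nat.mul_pos hp hm.1, by linarith [hm.2, mul_comm p m]⟩, dvd_mul_right _ _⟩
  · intro m _ m' _ h
    exact Nat.eq_of_mul_eq_mul_left hp h
  · intro n hn
    rw [Finset.mem_filter, Finset.mem_Ioc] at hn
    obtain ⟨⟨h0, hN⟩, m, rfl⟩ := hn
    refine ⟨m, ?_, rfl⟩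
    rw [Finset.mem_Ioc, Nat.le_div_iff_mul_le hp]
    exact ⟨Nat.pos_of_mul_pos_left h0, by linarith [mul_comm p m]⟩

/-- The Turán–Kubilius inequality for a finite set of primes. -/
theorem sum_primeDivisors_sub_sq_le {S : Finset ℕ} (hS : ∀ p ∈ S, p.Prime) (N : ℕ) :
    ∑ n ∈ Finset.Ioc 0 N, ((∑ p ∈ S, if p ∣ n then (1 : ℝ) else 0) - ∑ p ∈ S, (1 / p : ℝ)) ^ 2 ≤
      N * (∑ p ∈ S, (1 / p : ℝ)) + 2 * (∑ p ∈ S, (1 / p : ℝ)) * S.card := by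
  set W : ℝ := ∑ p ∈ S, (1 / p : ℝ) with hW
  have hW0 : 0 ≤ W := Finset.sum_nonneg fun p _ => by positivity
  set ω : ℕ → ℝ := fun n => ∑ p ∈ S, if p ∣ n then (1 : ℝ) else 0 with hω
  have hcount : ∀ d : ℕ, ∑ n ∈ Finset.Ioc 0 N, (if d ∣ n then (1 : ℝ) else 0) = (N / d : ℕ) := by
    intro d
    rw [← Nat.Ioc_filter_dvd_card_eq_div, Finset.sum_boole]
  have h1 : (N : ℝ) * W - S.card ≤ ∑ n ∈ Finset.Ioc 0 N, ω n := by
    rw [Finset.sum_comm, hW, Finset.mul_sum, Finset.card_eq_sum_ones, Nat.cast_sum,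
      ← Finset.sum_sub_distrib]
    refine Finset.sum_le_sum fun p hp => ?_
    rw [hcount, mul_one_div, Nat.cast_one, sub_le_iff_le_add]
    have := Nat.lt_floor_add_one ((N : ℝ) / p)
    rw [Nat.floor_div_natCast, Nat.floor_natCast] at this
    exact this.le
  have h2 : ∑ n ∈ Finset.Ioc 0 N, ω n ^ 2 ≤ N * (W ^ 2 + W) := by
    have : ∀ n, ω n ^ 2 = ∑ p ∈ S, ∑ q ∈ S, if p ∣ n ∧ q ∣ n then (1 : ℝ) else 0 := by
      intro n
      rw [sq, hω, Finset.sum_mul_sum]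
      refine Finset.sum_congr rfl fun p _ => Finset.sum_congr rfl fun q _ => ?_
      by_cases hp : p ∣ n <;> by_cases hq : q ∣ n <;> simp [hp, hq]
    rw [Finset.sum_congr rfl fun n _ => this n, Finset.sum_comm]
    have hinner : ∀ p ∈ S, ∑ n ∈ Finset.Ioc 0 N, ∑ q ∈ S,
        (if p ∣ n ∧ q ∣ n then (1 : ℝ) else 0) ≤ N * (1 / p * W + 1 / p) := by
      intro p hp
      rw [Finset.sum_comm]
      have hpq : ∀ q ∈ S, ∑ n ∈ Finset.Ioc 0 N, (if p ∣ n ∧ q ∣ n then (1 : ℝ) else 0) ≤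
          N * (1 / p * (1 / q)) + if q = p then N * (1 / p : ℝ) else 0 := by
        intro q hq
        split_ifs with h
        · subst h
          simp only [and_self]
          rw [hcount]
          have h5 : (0 : ℝ) ≤ N * (1 / q * (1 / q)) := by positivity
          have h6 : ((N / q : ℕ) : ℝ) ≤ N * (1 / q) :=
            Nat.cast_div_le.trans (le_of_eq (mul_one_div _ _).symm)
          linarith
        · have hco : Nat.Coprime p q := (Nat.coprime_primes (hS p hp) (hS q hq)).2 (Ne.symm h)
          have hiff : ∀ n, (p ∣ n ∧ q ∣ n) ↔ p * q ∣ n := fun n =>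
            ⟨fun h => hco.mul_dvd_of_dvd_of_dvd h.1 h.2,
              fun h => ⟨dvd_of_mul_right_dvd h, dvd_of_mul_left_dvd h⟩⟩
          simp only [hiff]
          rw [hcount, add_zero]
          refine Nat.cast_div_le.trans (le_of_eq ?_)
          push_cast
          ring
      refine (Finset.sum_le_sum hpq).trans (le_of_eq ?_)
      rw [Finset.sum_add_distrib, Finset.sum_ite_eq' S p, if_pos hp, ← Finset.mul_sum,
        ← Finset.mul_sum]
      ring
    refine (Finset.sum_le_sum hinner).trans (le_of_eq ?_)
    rw [← Finset.mul_sum, Finset.sum_add_distrib, ← Finset.sum_mul, sq]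
  have h3 : ∑ n ∈ Finset.Ioc 0 N, (ω n - W) ^ 2 =
      ∑ n ∈ Finset.Ioc 0 N, ω n ^ 2 - 2 * W * ∑ n ∈ Finset.Ioc 0 N, ω n + N * W ^ 2 := by
    rw [Finset.mul_sum, ← Finset.sum_sub_distrib]
    have : (N : ℝ) * W ^ 2 = ∑ n ∈ Finset.Ioc 0 N, W ^ 2 := by simp
    rw [this, ← Finset.sum_add_distrib]
    exact Finset.sum_congr rfl fun n _ => by ring
  rw [h3]
  -- `N(W² + W) - 2W(NW - |S|) + NW² = NW + 2W|S|`.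
  nlinarith

/-- Since `Ω(pm) = Ω(m) + 1`, the sum is the mean of `a (Ω n)` against `ω n - W`; Cauchy–Schwarz and
Turán–Kubilius then apply. -/
theorem sum_omegaAverage_sub_sq_le {a : ℕ → ℝ} (ha : ∀ k, |a k| ≤ 1) {S : Finset ℕ}
    (hS : ∀ p ∈ S, p.Prime) {x : ℝ} (hx : 0 < x) :
    (∑ p ∈ S, (1 / p : ℝ) * (omegaAverage (fun k => a (k + 1)) (x / p) - omegaAverage a x)) ^ 2 ≤
      ∑ p ∈ S, (1 / p : ℝ) + 2 * (∑ p ∈ S, (1 / p : ℝ)) * S.card / x := by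
  set W : ℝ := ∑ p ∈ S, (1 / p : ℝ) with hW
  have hW0 : 0 ≤ W := Finset.sum_nonneg fun p _ => by positivity
  set N := ⌊x⌋₊ with hN
  have hNx : (N : ℝ) ≤ x := Nat.floor_le hx.le
  set b : ℕ → ℝ := fun n => a (ArithmeticFunction.cardFactors n) with hb
  set ω : ℕ → ℝ := fun n => ∑ p ∈ S, if p ∣ n then (1 : ℝ) else 0 with hω
  have hkey : ∑ p ∈ S, (1 / p : ℝ) *
      (omegaAverage (fun k => a (k + 1)) (x / p) - omegaAverage a x) =
      (1 / x) * ∑ n ∈ Finset.Ioc 0 N, b n * (ω n - W) := by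
    have h1 : ∑ n ∈ Finset.Ioc 0 N, b n * ω n =
        ∑ p ∈ S, ∑ m ∈ Finset.Ioc 0 (N / p), a (ArithmeticFunction.cardFactors m + 1) := by
      simp only [hω, Finset.mul_sum]
      rw [Finset.sum_comm]
      refine Finset.sum_congr rfl fun p hp => ?_
      simp only [mul_ite, mul_one, mul_zero]
      rw [← Finset.sum_filter, sum_filter_dvd_Ioc (hS p hp).pos]
      refine Finset.sum_congr rfl fun m hm => ?_
      rw [hb]
      simp only
      rw [ArithmeticFunction.cardFactors_mul (hS p hp).ne_zero
        (Finset.mem_Ioc.1 hm).1.ne', ArithmeticFunction.cardFactors_apply_prime (hS p hp), add_comm]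
    have h2 : ∑ n ∈ Finset.Ioc 0 N, b n * (ω n - W) =
        ∑ n ∈ Finset.Ioc 0 N, b n * ω n - W * ∑ n ∈ Finset.Ioc 0 N, b n := by
      rw [Finset.mul_sum, ← Finset.sum_sub_distrib]
      exact Finset.sum_congr rfl fun n _ => by ring
    rw [h2, h1, hW, Finset.sum_mul, ← Finset.sum_sub_distrib, Finset.mul_sum]
    refine Finset.sum_congr rfl fun p hp => ?_
    have hp0 : (p : ℝ) ≠ 0 := by exact_mod_cast (hS p hp).ne_zero
    rw [omegaAverage, omegaAverage, Nat.floor_div_natCast]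
    field_simp
    rfl
  have hCS := Finset.sum_mul_sq_le_sq_mul_sq (Finset.Ioc 0 N) b (fun n => ω n - W)
  have hb2 : ∑ n ∈ Finset.Ioc 0 N, b n ^ 2 ≤ x := by
    refine (Finset.sum_le_card_nsmul _ _ 1 fun n _ => ?_).trans ?_
    · exact (sq_le_one_iff_abs_le_one _).2 (ha _)
    · simpa using hNx
  have hTK := sum_primeDivisors_sub_sq_le hS N
  have hfin : (∑ n ∈ Finset.Ioc 0 N, b n * (ω n - W)) ^ 2 ≤ x * (x * W + 2 * W * S.card) := by
    refine hCS.trans (mul_le_mul hb2 (hTK.trans ?_) (Finset.sum_nonneg fun _ _ => sq_nonneg _) hx.le)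
    gcongr
  rw [hkey, mul_pow, one_div_pow, one_div_mul_eq_div, div_le_iff₀ (by positivity)]
  refine hfin.trans (le_of_eq ?_)
  field_simp

/-! ### Ultrafilter limits on the logarithmic scale -/

theorem exists_omegaAverage_limit {a : ℕ → ℝ} (ha : ∀ k, |a k| ≤ 1) {U : Ultrafilter ℝ}
    (hU : (U : Filter ℝ) ≤ atTop) :
    ∃ F : ℝ → ℝ, ∀ t, Tendsto (fun x => omegaAverage a (x * Real.exp t)) U (𝓝 (F t)) := by
  have : ∀ t, ∃ y, Tendsto (fun x => omegaAverage a (x * Real.exp t)) U (𝓝 y) := by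
    intro t
    obtain ⟨y, -, hy⟩ := (isCompact_Icc (a := (-1 : ℝ)) (b := 1)).ultrafilter_le_nhds
      (U.map fun x => omegaAverage a (x * Real.exp t)) (by
        rw [le_principal_iff]
        refine hU (mem_map.2 ?_)
        filter_upwards [eventually_gt_atTop 0] with x hx
        exact abs_le.1 (abs_omegaAverage_le ha (mul_pos hx (Real.exp_pos t))))
    exact ⟨y, hy⟩
  choose F hF using this
  exact ⟨F, hF⟩

theorem omegaAverage_limit_lipschitz {a : ℕ → ℝ} (ha : ∀ k, |a k| ≤ 1) {U : Ultrafilter ℝ}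
    (hU : (U : Filter ℝ) ≤ atTop) {F : ℝ → ℝ}
    (hF : ∀ t, Tendsto (fun x => omegaAverage a (x * Real.exp t)) U (𝓝 (F t))) (s t : ℝ) :
    |F t - F s| ≤ 2 * |t - s| := by
  wlog hst : s ≤ t generalizing s t
  · rw [abs_sub_comm, abs_sub_comm t s]
    exact this t s (le_of_not_ge hst)
  have hlim : Tendsto (fun x : ℝ => 2 * (1 - Real.exp (s - t)) + 1 / (x * Real.exp t)) U
      (𝓝 (2 * (1 - Real.exp (s - t)) + 0)) := by
    refine tendsto_const_nhds.add (Tendsto.mono_left ?_ hU)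
    exact (tendsto_id.atTop_mul_const (Real.exp_pos t)).const_div_atTop 1
  have hle := le_of_tendsto_of_tendsto ((hF t).sub (hF s)).abs hlim (by
    refine hU ?_
    filter_upwards [eventually_gt_atTop 0] with x hx
    have h := abs_omegaAverage_sub_le ha (mul_pos hx (Real.exp_pos s))
      (mul_le_mul_of_nonneg_left (Real.exp_le_exp.2 hst) hx.le)
    rwa [mul_div_mul_left _ _ hx.ne', ← Real.exp_sub] at h)
  rw [abs_of_nonneg (sub_nonneg.2 hst)]
  linarith [Real.add_one_le_exp (s - t)]

theorem omegaAverage_limit_sum_sq_le {a : ℕ → ℝ} (ha : ∀ k, |a k| ≤ 1) {U : Ultrafilter ℝ}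
    (hU : (U : Filter ℝ) ≤ atTop) {F G : ℝ → ℝ}
    (hF : ∀ t, Tendsto (fun x => omegaAverage a (x * Real.exp t)) U (𝓝 (F t)))
    (hG : ∀ t, Tendsto (fun x => omegaAverage (fun k => a (k + 1)) (x * Real.exp t)) U (𝓝 (G t)))
    (t : ℝ) {S : Finset ℕ} (hS : ∀ p ∈ S, p.Prime) :
    (∑ p ∈ S, (1 / p : ℝ) * (G (t - Real.log p) - F t)) ^ 2 ≤ ∑ p ∈ S, (1 / p : ℝ) := by
  set W : ℝ := ∑ p ∈ S, (1 / p : ℝ) with hW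
  have hlim : Tendsto (fun x : ℝ => W + 2 * W * S.card / (x * Real.exp t)) U (𝓝 (W + 0)) := by
    refine tendsto_const_nhds.add (Tendsto.mono_left ?_ hU)
    exact (tendsto_id.atTop_mul_const (Real.exp_pos t)).const_div_atTop _
  rw [add_zero] at hlim
  refine le_of_tendsto_of_tendsto (Tendsto.pow (tendsto_finsetSum S fun p _ =>
    ((hG (t - Real.log p)).sub (hF t)).const_mul (1 / p : ℝ)) 2) hlim ?_
  refine hU ?_
  filter_upwards [eventually_gt_atTop 0] with x hx
  refine le_trans (le_of_eq ?_) (sum_omegaAverage_sub_sq_le ha hS (mul_pos hx (Real.exp_pos t)))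
  congr 1
  refine Finset.sum_congr rfl fun p hp => ?_
  have hp0 : (0 : ℝ) < p := by exact_mod_cast (hS p hp).pos
  rw [Real.exp_sub, Real.exp_log hp0, mul_div_assoc]

/-- `F t` and `G (t - log p)` agree up to `ε` for all primes `p` outside a set with bounded sum of
reciprocals. -/
def AlmostShift (F G : ℝ → ℝ) : Prop :=
  ∀ t ε : ℝ, 0 < ε → ∀ S : Finset ℕ,
    (∀ p ∈ S, p.Prime ∧ ε ≤ |F t - G (t - Real.log p)|) → ∑ p ∈ S, (1 / p : ℝ) ≤ 2 / ε ^ 2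

theorem omegaAverage_limit_almostShift {a : ℕ → ℝ} (ha : ∀ k, |a k| ≤ 1) {U : Ultrafilter ℝ}
    (hU : (U : Filter ℝ) ≤ atTop) {F G : ℝ → ℝ}
    (hF : ∀ t, Tendsto (fun x => omegaAverage a (x * Real.exp t)) U (𝓝 (F t)))
    (hG : ∀ t, Tendsto (fun x => omegaAverage (fun k => a (k + 1)) (x * Real.exp t)) U (𝓝 (G t))) :
    AlmostShift F G := by
  classical
  intro t ε hε S hS
  -- The primes are split by the sign `σ` of the deviation, to rule out cancellation; then `(ε W)² ≤
  -- W`.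
  have key : ∀ S' : Finset ℕ, S' ⊆ S → ∀ σ : ℝ, σ ^ 2 = 1 →
      (∀ p ∈ S', ε ≤ σ * (G (t - Real.log p) - F t)) → ∑ p ∈ S', (1 / p : ℝ) ≤ 1 / ε ^ 2 := by
    intro S' hS' σ hσ h
    have hsq := omegaAverage_limit_sum_sq_le ha hU hF hG t (S := S') fun p hp => (hS p (hS' hp)).1
    set W : ℝ := ∑ p ∈ S', (1 / p : ℝ) with hW
    have hW0 : 0 ≤ W := Finset.sum_nonneg fun p _ => by positivity
    have hle : ε * W ≤ σ * ∑ p ∈ S', (1 / p : ℝ) * (G (t - Real.log p) - F t) := by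
      rw [hW, Finset.mul_sum, Finset.mul_sum]
      refine Finset.sum_le_sum fun p hp => ?_
      have := mul_le_mul_of_nonneg_left (h p hp) (show (0 : ℝ) ≤ 1 / p by positivity)
      linarith
    have h2 : (ε * W) ^ 2 ≤ W := by
      refine (pow_le_pow_left₀ (by positivity) hle 2).trans ?_
      rwa [mul_pow, hσ, one_mul]
    rcases hW0.eq_or_lt with h0 | h0
    · rw [← h0]
      positivity
    · rw [le_div_iff₀ (by positivity)]
      nlinarith
  rw [← Finset.sum_filter_add_sum_filter_not S (fun p : ℕ => ε ≤ G (t - Real.log p) - F t)]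
  have h1 := key _ (Finset.filter_subset (fun p : ℕ => ε ≤ G (t - Real.log p) - F t) S) 1 (by norm_num)
    (fun p hp => by simpa using (Finset.mem_filter.1 hp).2)
  have h2 := key _ (Finset.filter_subset (fun p : ℕ => ¬ ε ≤ G (t - Real.log p) - F t) S) (-1)
    (by norm_num) (fun p hp => by
      obtain ⟨hp1, hp2⟩ := Finset.mem_filter.1 hp
      have := (hS p hp1).2
      rcases le_abs.1 this with h | h <;> linarith)
  refine (add_le_add h1 h2).trans (le_of_eq (by ring))

/-! ### Constancy of the limits -/

theorem AlmostShift.sum_le {F G : ℝ → ℝ} (h : AlmostShift F G) (A : Finset ℝ) {ε : ℝ} (hε : 0 < ε)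
    {S : Finset ℕ} (hS : ∀ p ∈ S, p.Prime ∧ p ∈ {p : ℕ | ∃ t ∈ A, ε ≤ |F t - G (t - Real.log p)|}) :
    ∑ p ∈ S, (1 / p : ℝ) ≤ A.card * (2 / ε ^ 2) := by
  classical
  calc ∑ p ∈ S, (1 / p : ℝ)
      ≤ ∑ p ∈ S, ∑ t ∈ A, if ε ≤ |F t - G (t - Real.log p)| then (1 / p : ℝ) else 0 := by
        refine Finset.sum_le_sum fun p hp => ?_
        obtain ⟨-, t, ht, h'⟩ := hS p hp
        refine le_trans (le_of_eq (if_pos h').symm)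
          (Finset.single_le_sum (f := fun t => if ε ≤ |F t - G (t - Real.log p)| then (1 / p : ℝ) else 0)
            (fun t _ => ?_) ht)
        split_ifs <;> positivity
    _ = ∑ t ∈ A, ∑ p ∈ S.filter (fun p : ℕ => ε ≤ |F t - G (t - Real.log p)|), (1 / p : ℝ) := by
        rw [Finset.sum_comm]
        exact Finset.sum_congr rfl fun t _ => (Finset.sum_filter _ _).symm
    _ ≤ ∑ t ∈ A, 2 / ε ^ 2 := Finset.sum_le_sum fun t _ => h t ε hε _ fun p hp =>
        ⟨(hS p (Finset.mem_filter.1 hp).1).1, (Finset.mem_filter.1 hp).2⟩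
    _ = A.card * (2 / ε ^ 2) := by simp

theorem AlmostShift.abs_sub_le {F G : ℝ → ℝ} (h : AlmostShift F G)
    (hF : ∀ s t, |F t - F s| ≤ 2 * |t - s|) (hG : ∀ s t, |G t - G s| ≤ 2 * |t - s|)
    {x y η : ℝ} (hxy : x ≤ y) (h0 : 0 < η) (h1 : η ≤ 1) :
    |F y - F x| ≤ η * (y - x) + 2 * η := by
  classical
  obtain ⟨δ, hδ, hpair⟩ := exists_prime_pair h0 h1
  have hl : 0 < Real.log (1 + δ) := Real.log_pos (by linarith)
  -- A step costs `10 * ε` and advances by at least `log (1 + δ)`, so the cost per unit length is at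
  -- most `η`. The grid makes the exceptional set a finite union; the Lipschitz bounds fill the
  -- gaps.
  set ε := η * Real.log (1 + δ) / 10 with hε
  have hε0 : 0 < ε := by positivity
  let grid : ℕ → ℝ := fun i => x + i * ε
  let A : Finset ℝ := (Finset.range (⌊(y - x) / ε⌋₊ + 1)).image grid
  obtain ⟨p, q, hp, hq, hpE, hqE, hpq1, hpq2⟩ :=
    hpair {p : ℕ | ∃ t ∈ A, ε ≤ |F t - G (t - Real.log p)|} _ fun S hS => h.sum_le A hε0 hS
  have hgood : ∀ p : ℕ, p ∉ {p : ℕ | ∃ t ∈ A, ε ≤ |F t - G (t - Real.log p)|} →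
      ∀ t, x ≤ t → t ≤ y → |F t - G (t - Real.log p)| ≤ 5 * ε := by
    intro p hp t hxt hty
    set i := ⌊(t - x) / ε⌋₊ with hi
    have hiA : grid i ∈ A := by
      refine Finset.mem_image_of_mem _ (Finset.mem_range.2 (Nat.lt_succ_iff.2 ?_))
      exact Nat.floor_le_floor (by gcongr)
    have h2 : |F (grid i) - G (grid i - Real.log p)| < ε := by
      by_contra hcon
      exact hp ⟨_, hiA, not_lt.1 hcon⟩
    have h3 : |t - grid i| ≤ ε := by
      have h4 := Nat.floor_le (show 0 ≤ (t - x) / ε from div_nonneg (by linarith) hε0.le)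
      have h5 := Nat.lt_floor_add_one ((t - x) / ε)
      rw [le_div_iff₀ hε0] at h4
      rw [div_lt_iff₀ hε0] at h5
      rw [abs_le]
      constructor <;> simp only [grid] <;> linarith
    have h6 := hF (grid i) t
    have h7 := hG (t - Real.log p) (grid i - Real.log p)
    rw [show grid i - Real.log p - (t - Real.log p) = -(t - grid i) by ring, abs_neg] at h7
    rw [abs_le] at h6 h7 ⊢
    rw [abs_lt] at h2
    constructor <;> linarith [h6.1, h6.2, h7.1, h7.2, h2.1, h2.2]
  have hp0 : (0 : ℝ) < p := by exact_mod_cast hp.pos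
  have hq0 : (0 : ℝ) < q := by exact_mod_cast hq.pos
  set d := Real.log q - Real.log p with hd
  have hd1 : Real.log (1 + δ) ≤ d := by
    have := Real.log_le_log (by positivity) hpq1
    rw [Real.log_mul (by positivity) hp0.ne'] at this
    linarith
  have hd2 : d ≤ η := by
    have := Real.log_le_log hq0 hpq2
    rw [Real.log_mul (by positivity) hp0.ne'] at this
    linarith [Real.log_le_sub_one_of_pos (show 0 < 1 + η by linarith)]
  have hd0 : 0 < d := hl.trans_le hd1
  have hstep : ∀ s, x ≤ s → s + d ≤ y → |F (s + d) - F s| ≤ 10 * ε := by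
    intro s hs hsy
    have h2 := hgood p hpE s hs (by linarith)
    have h3 := hgood q hqE (s + d) (by linarith) hsy
    -- Both primes lead to the same value of `G`.
    rw [show s + d - Real.log q = s - Real.log p by rw [hd]; ring] at h3
    rw [abs_le] at *
    constructor <;> linarith [h2.1, h2.2, h3.1, h3.2]
  have hiter : ∀ k : ℕ, x + k * d ≤ y → |F (x + k * d) - F x| ≤ k * (10 * ε) := by
    intro k
    induction k with
    | zero => simp
    | succ k ih =>
      intro hk
      push_cast at hk ⊢
      have h2 := ih (by linarith)
      have h3 := hstep (x + k * d) (by have := mul_nonneg k.cast_nonneg hd0.le; linarith)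
        (by linarith)
      rw [show x + (k + 1) * d = x + k * d + d by ring]
      rw [abs_le] at *
      constructor <;> linarith [h2.1, h2.2, h3.1, h3.2]
  have hk1 := Nat.floor_le (show 0 ≤ (y - x) / d from div_nonneg (by linarith) hd0.le)
  have hk2 := Nat.lt_floor_add_one ((y - x) / d)
  set k := ⌊(y - x) / d⌋₊ with hk
  rw [le_div_iff₀ hd0] at hk1
  rw [div_lt_iff₀ hd0] at hk2
  have h2 := hiter k (by linarith)
  have h3 := hF (x + k * d) y
  rw [abs_of_nonneg (by linarith : 0 ≤ y - (x + k * d))] at h3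
  have h4 : k * (10 * ε) ≤ η * (y - x) := by
    have h5 : (k : ℝ) * Real.log (1 + δ) ≤ y - x :=
      (mul_le_mul_of_nonneg_left hd1 k.cast_nonneg).trans hk1
    calc k * (10 * ε) = η * (k * Real.log (1 + δ)) := by rw [hε]; ring
      _ ≤ η * (y - x) := by gcongr
  calc |F y - F x| = |(F y - F (x + k * d)) + (F (x + k * d) - F x)| := by ring_nf
    _ ≤ |F y - F (x + k * d)| + |F (x + k * d) - F x| := abs_add_le _ _
    _ ≤ η * (y - x) + 2 * η := by linarith

theorem AlmostShift.eq_of_le {F G : ℝ → ℝ} (h : AlmostShift F G)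
    (hF : ∀ s t, |F t - F s| ≤ 2 * |t - s|) (hG : ∀ s t, |G t - G s| ≤ 2 * |t - s|)
    {x y : ℝ} (hxy : x ≤ y) : F y = F x := by
  have hlim : Tendsto (fun η : ℝ => η * (y - x) + 2 * η) (𝓝[>] 0) (𝓝 (0 * (y - x) + 2 * 0)) :=
    (Continuous.tendsto (by fun_prop) 0).mono_left nhdsWithin_le_nhds
  have hle : |F y - F x| ≤ 0 * (y - x) + 2 * 0 := by
    refine ge_of_tendsto hlim ?_
    filter_upwards [Ioc_mem_nhdsGT (show (0 : ℝ) < 1 by norm_num)] with η hη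
    exact h.abs_sub_le hF hG hxy hη.1 hη.2
  rw [zero_mul, mul_zero, add_zero] at hle
  exact sub_eq_zero.1 (abs_nonpos_iff.1 hle)

theorem omegaAverage_limit_shift {a : ℕ → ℝ} (ha : ∀ k, |a k| ≤ 1) {U : Ultrafilter ℝ}
    (hU : (U : Filter ℝ) ≤ atTop) :
    Tendsto (fun x => omegaAverage (fun k => a (k + 1)) x - omegaAverage a x) U (𝓝 0) := by
  obtain ⟨F, hF⟩ := exists_omegaAverage_limit ha hU
  have ha' : ∀ k, |(fun k => a (k + 1)) k| ≤ 1 := fun k => ha _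
  obtain ⟨G, hG⟩ := exists_omegaAverage_limit ha' hU
  have ha'' : ∀ k, |(fun k => a (k + 1 + 1)) k| ≤ 1 := fun k => ha _
  obtain ⟨H, hH⟩ := exists_omegaAverage_limit ha'' hU
  have hFL := omegaAverage_limit_lipschitz ha hU hF
  have hGL := omegaAverage_limit_lipschitz ha' hU hG
  have hHL := omegaAverage_limit_lipschitz ha'' hU hH
  have hFG := omegaAverage_limit_almostShift ha hU hF hG
  have hGH := omegaAverage_limit_almostShift ha' hU hG hH
  have heq : G 0 = F 0 := by
    refine eq_of_forall_dist_le fun ε hε => ?_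
    -- Only one prime outside the exceptional set is needed here.
    obtain ⟨δ, -, hpair⟩ := exists_prime_pair one_pos le_rfl
    obtain ⟨p, -, hp, -, hpE, -⟩ := hpair {p : ℕ | ε ≤ |F 0 - G (0 - Real.log p)|} _
      fun S hS => hFG 0 ε hε S hS
    have hlog := Real.log_natCast_nonneg p
    rw [Set.mem_ofPred_eq, ← hGH.eq_of_le hGL hHL (by linarith : 0 - Real.log p ≤ 0), not_le] at hpE
    rw [dist_comm, Real.dist_eq]
    exact hpE.le
  have := (hG 0).sub (hF 0)
  simpa only [heq, sub_self, Real.exp_zero, mul_one] using this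

theorem tendsto_omegaAverage_shift {a : ℕ → ℝ} (ha : ∀ k, |a k| ≤ 1) :
    Tendsto (fun N : ℕ => omegaAverage (fun k => a (k + 1)) N - omegaAverage a N) atTop (𝓝 0) := by
  refine Tendsto.comp (g := fun x : ℝ => omegaAverage (fun k => a (k + 1)) x - omegaAverage a x) ?_
    tendsto_natCast_atTop_atTop
  rw [Filter.tendsto_iff_ultrafilter]
  exact fun U hU => omegaAverage_limit_shift ha hU

theorem tendsto_omegaAverage_shift_of_bounded {a : ℕ → ℝ} {C : ℝ} (ha : ∀ k, |a k| ≤ C) :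
    Tendsto (fun N : ℕ => omegaAverage (fun k => a (k + 1)) N - omegaAverage a N) atTop (𝓝 0) := by
  have hC : 0 ≤ C := (abs_nonneg _).trans (ha 0)
  have hscale : ∀ b : ℕ → ℝ, ∀ x, omegaAverage b x =
      (C + 1) * omegaAverage (fun k => b k / (C + 1)) x := by
    intro b x
    have : C + 1 ≠ 0 := by positivity
    simp only [omegaAverage, ← Finset.sum_div]
    field_simp
  have h := (tendsto_omegaAverage_shift (a := fun k => a k / (C + 1)) fun k => by
    rw [abs_div, abs_of_pos (by positivity : 0 < C + 1), div_le_one (by positivity)]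
    linarith [ha k]).const_mul (C + 1)
  rw [mul_zero] at h
  refine h.congr fun N => ?_
  rw [hscale (fun k => a (k + 1)), hscale a]
  ring

/-! ### Empirical measures and invariance -/

/-- The uniform probability measure on the points `y 1, …, y (N + 1)`, with multiplicity. -/
noncomputable def empiricalMeasure {X : Type*} [MeasurableSpace X] (y : ℕ → X) (N : ℕ) :
    ProbabilityMeasure X :=
  ⟨((N + 1 : ℕ) : ENNReal)⁻¹ • ∑ n ∈ Finset.Ioc 0 (N + 1), Measure.dirac (y n), ⟨by
    simp only [Measure.smul_apply, Measure.finsetSum_apply, measure_univ, smul_eq_mul,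
      Finset.sum_const, Nat.card_Ioc, Nat.sub_zero, nsmul_eq_mul, mul_one]
    exact ENNReal.inv_mul_cancel (by simp) (ENNReal.natCast_ne_top _)⟩⟩

theorem integral_empiricalMeasure {X E : Type*} [TopologicalSpace X] [MeasurableSpace X]
    [MeasurableSingletonClass X] [NormedAddCommGroup E]
    [NormedSpace ℝ E] [CompleteSpace E] (y : ℕ → X) (N : ℕ) (f : X → E) :
    ∫ z, f z ∂(empiricalMeasure y N : Measure X) =
      (1 / ((N + 1 : ℕ) : ℝ)) • ∑ n ∈ Finset.Ioc 0 (N + 1), f (y n) := by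
  have hint : ∀ n ∈ Finset.Ioc 0 (N + 1), Integrable f (Measure.dirac (y n)) := fun n _ =>
    integrable_dirac (by simp)
  change ∫ z, f z ∂(((N + 1 : ℕ) : ENNReal)⁻¹ •
    ∑ n ∈ Finset.Ioc 0 (N + 1), Measure.dirac (y n)) = _
  rw [integral_smul_measure, integral_finsetSum_measure hint, ENNReal.toReal_inv,
    ENNReal.toReal_natCast, one_div]
  simp only [integral_dirac]

theorem isInvariantProbability_of_forall_integral {X : Type*} [TopologicalSpace X]
    [HasOuterApproxClosed X] [MeasurableSpace X] [BorelSpace X] {T : X → X} (hT : Continuous T)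
    (ν : Measure X) [IsProbabilityMeasure ν]
    (h : ∀ f : BoundedContinuousFunction X ℝ, ∫ z, f (T z) ∂ν = ∫ z, f z ∂ν) :
    IsInvariantProbability T ν := by
  have : IsProbabilityMeasure (ν.map T) := Measure.isProbabilityMeasure_map hT.aemeasurable
  have heq : ν.map T = ν := by
    refine ext_of_forall_integral_eq_of_IsFiniteMeasure fun f => ?_
    rw [integral_map hT.aemeasurable f.continuous.aestronglyMeasurable, h]
  refine ⟨inferInstance, fun A hA => ?_⟩
  rw [← Measure.map_apply hT.measurable hA, heq]

theorem tendsto_empiricalMeasure {X : Type*} [MetricSpace X] [CompactSpace X] [MeasurableSpace X]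
    [BorelSpace X] {T : X → X} (hT : Continuous T) (hX : IsUniquelyErgodic T)
    (μ : ProbabilityMeasure X) (hμ : IsInvariantProbability T (μ : Measure X)) (x : X) :
    Tendsto (empiricalMeasure fun n => T^[ArithmeticFunction.cardFactors n] x) atTop (𝓝 μ) := by
  set ν := empiricalMeasure fun n => T^[ArithmeticFunction.cardFactors n] x with hν
  rw [Filter.tendsto_iff_ultrafilter]
  intro U hU
  obtain ⟨ρ, -, hρ⟩ := (isCompact_univ (X := ProbabilityMeasure X)).ultrafilter_le_nhds (U.map ν)
    (by simp)
  have hρ' : Tendsto ν U (𝓝 ρ) := hρ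
  have hlim := ProbabilityMeasure.tendsto_iff_forall_integral_tendsto.1 hρ'
  have hinv : IsInvariantProbability T (ρ : Measure X) := by
    refine isInvariantProbability_of_forall_integral hT _ fun f => ?_
    have h1 := (hlim (f.compContinuous ⟨T, hT⟩)).sub (hlim f)
    -- The index moves by one because `empiricalMeasure y N` averages `N + 1` points.
    have h2 := ((tendsto_omegaAverage_shift_of_bounded (a := fun k => f (T^[k] x)) (C := ‖f‖)
      fun k => f.norm_coe_le_norm _).comp (tendsto_add_atTop_nat 1)).mono_left hU
    refine sub_eq_zero.1 (tendsto_nhds_unique h1 (h2.congr fun N => ?_))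
    rw [hν, integral_empiricalMeasure, integral_empiricalMeasure]
    simp only [omegaAverage, Function.comp_apply, Nat.floor_natCast, smul_eq_mul,
      Function.iterate_succ_apply', BoundedContinuousFunction.compContinuous_apply,
      ContinuousMap.coe_mk]
  have : ρ = μ := Subtype.ext (hX.unique hinv hμ)
  exact this ▸ hρ'

theorem theoremA {X : Type*} [MetricSpace X] [CompactSpace X] [MeasurableSpace X] [BorelSpace X]
    (T : X → X) (hT : Continuous T) (hX : IsUniquelyErgodic T)
    (μ : Measure X) (hμ : IsInvariantProbability T μ)
    (x : X) (f : C(X, ℂ)) :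
    Tendsto
      (fun N : ℕ => (1 / (N : ℂ)) *
        ∑ n ∈ Finset.Icc 1 N, f (T^[ArithmeticFunction.cardFactors n] x))
      atTop (𝓝 (∫ y, f y ∂μ)) := by
  have h := (ProbabilityMeasure.tendsto_iff_forall_integral_rclike_tendsto ℂ).1
    (tendsto_empiricalMeasure hT hX ⟨μ, hμ.isProbabilityMeasure⟩ hμ x)
    (BoundedContinuousFunction.mkOfCompact f)
  rw [← tendsto_add_atTop_iff_nat 1]
  refine h.congr fun N => ?_
  rw [integral_empiricalMeasure, Complex.real_smul]
  push_cast
  rfl
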